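/- A word over an alphabet is cube-free if it has no factor (contiguous block) of the form $xxx$ with $x$ a nonempty finite word; this applies to finite, right-infinite and left-infinite words. A finite cube-free word $u$ over a fixed alphabet $\Sigma$ is right extendable if there is a right-infinite word $\mathbf{s}$ over $\Sigma$ such that $u\mathbf{s}$ is cube-free; a finite cube-free word $v$ over $\Sigma$ is left extendable if there is a left-infinite word $\mathbf{s}$ over $\Sigma$ such that $\mathbf{s}v$ is cube-free. Theorem. Let $d \ge 3$ and let $\Sigma_d$ be an alphabet of $d$ letters. For every pair $(u,v)$ of finite cube-free words over $\Sigma_d$ such that $u$ is right extendable and $v$ is left extendable (over $\Sigma_d$), there exists a finite (possibly empty) word $w$ over $\Sigma_d$ such that $uwv$ is cube-free. -/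

import Mathlib

namespace CubeFreeWords

variable {α : Type*}

/-- A cube: a word of the form `x x x` with `x` nonempty. -/
def IsCube (c : List α) : Prop :=
  ∃ x : List α, x ≠ [] ∧ c = x ++ x ++ x

/-- A finite word is cube-free if none of its factors (contiguous blocks) is a cube. -/
def CubeFree (w : List α) : Prop :=
  ∀ c : List α, c <:+: w → ¬ IsCube c

/-- The finite word `x` is a factor of the right-infinite word `s`: it occurs in `s` starting at
some position `n`. -/
def IsFactorInf (x : List α) (s : Stream' α) : Prop :=
  ∃ n : ℕ, (s.drop n).take x.length = x

/-- The right-infinite word `s 0, s 1, s 2, …` is cube-free. -/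
def CubeFreeRightInf (s : Stream' α) : Prop :=
  ∀ c : List α, IsFactorInf c s → ¬ IsCube c

/-- The left-infinite word `…, s 2, s 1, s 0` is cube-free. Left-infinite words are given by their
letters listed from right to left, so the factors of such a word are the words whose
reversal occurs in `s`. -/
def CubeFreeLeftInf (s : Stream' α) : Prop :=
  ∀ c : List α, IsFactorInf c.reverse s → ¬ IsCube c

/-- `u` is right extendable: there is a right-infinite word `s` such that the right-infinite word
`u s` is cube-free. -/
def RightExtendable (u : List α) : Prop :=
  ∃ s : Stream' α, CubeFreeRightInf (u ++ₛ s)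

/-- `v` is left extendable: there is a left-infinite word `s` such that the left-infinite word
`s v` is cube-free (read from right to left, the word `s v` is `v.reverse` followed
by the letters of `s`). -/
def LeftExtendable (v : List α) : Prop :=
  ∃ s : Stream' α, CubeFreeLeftInf (v.reverse ++ₛ s)

end CubeFreeWords

/-!
The proof counts cube-free extensions. Words are mostly listed towards the place where they grow,
so that the head of a list is the newest letter, and adding a letter is `List.cons`. In this way the
right extensions of `u` and the left extensions of `v` are treated by the same lemmas.

**Growth from a small potential.** If the last `m` letters of a word repeat the letters `p` places
before them, then `2p - m` further repetitions complete a cube of period `p`. The potential is the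
sum of `(5/2) ^ (m - 2p)` over all periods `p`; a cube at the end forces it to be at least `1`.
The potentials of the one-letter extensions of `z` over at least three letters add up to at most
`5/2` times the potential of `z` plus a small constant, because every period is continued by at most
one letter. Hence a word of potential less than `1` has at least a constant times `(5/2) ^ n`
cube-free extensions by `n` letters (`le_card_extensions`).

**Reaching a small potential.** Let `W` be an infinite cube-free word that starts with the given
one. If changing the letter of `W` at a position `N` always gave a large potential, then for two
different letters there would be runs that end just before `N`, would be continued by that letter,
and are nearly cubes. Every such run distributes a charge over the positions of an interval inside
it, in such a way that a run one letter short of a cube hands out `1`, and that the charges of the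
runs continued by one letter add up to at least `1` (`one_le_sum_charge`). On the other hand
a position belongs to at most one interval for each period, and the periods `p ≥ 6` that occur at
one position grow by a factor greater than `3/2` (`Covers.lacunary`). So a position receives at most
`1/2 + 1/4 + 1/6 + 1/8 + 1/10 + 1/2 < 2` (`sum_share_le`), contradicting the average of at least
`2` per position. This gives `exists_small_potential`.

**Joining.** As `9/4 < 5/2`, there are arbitrarily large `n` at which the number of extensions is
a record relative to `(9/4) ^ n`, so that shortening the extensions by `k` letters divides their
number by at least `(9/4) ^ k`. Take record lengths for `u` and for `v` and join all pairs of
extensions. A cube of period `p` in a joined word crosses the junction, and for each of the fewer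
than `3p` places where it can lie, the pair is determined by what is left after removing `2p` letters
around the junction (`card_cubeAt_le`). So at most the fraction `∑ 3p (16/81) ^ p < 1` of the pairs
is lost, and some joined word is cube-free (`exists_cubeFree_joined`).
-/

namespace CubeFreeWords

open Finset
open scoped Classical

variable {α : Type*}

/-! ### Cubes by position -/

/-- The list `Q` carries a cube of period `p` in the positions `c, …, c + 3p - 1`. -/
def CubeAt (Q : List α) (c p : ℕ) : Prop :=
  0 < p ∧ c + 3 * p ≤ Q.length ∧ ∀ j, c ≤ j → j < c + 2 * p → Q[j]? = Q[j + p]?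

lemma isCube_getElem? {x : List α} {i : ℕ} (hi : i < 2 * x.length) :
    (x ++ x ++ x)[i]? = (x ++ x ++ x)[i + x.length]? := by
  have h : (x ++ x ++ x)[i + x.length]? = (x ++ x)[i]? := by
    rw [List.append_assoc, List.getElem?_append_right (by omega), Nat.add_sub_cancel]
  rw [h, List.getElem?_append_left (by simp; omega)]

lemma cubeFree_iff {Q : List α} : CubeFree Q ↔ ∀ c p, ¬ CubeAt Q c p := by
  constructor
  · rintro h c p ⟨hp, hl, hj⟩
    refine h ((Q.drop c).take (3 * p)) ?_ ⟨(Q.drop c).take p, ?_, ?_⟩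
    · exact ((List.take_prefix _ _).isInfix).trans (List.drop_suffix _ _).isInfix
    · intro h0
      have := congrArg List.length h0
      simp at this
      omega
    · have hx : ((Q.drop c).take p).length = p := by simp; omega
      apply List.ext_getElem?
      intro i
      rcases lt_or_ge i p with h1 | h1
      · rw [List.append_assoc, List.getElem?_append_left (by omega)]
        simp [h1, show i < 3 * p by omega]
      rcases lt_or_ge i (2 * p) with h2 | h2
      · rw [List.getElem?_append_left (by simp only [List.length_append]; omega),
          List.getElem?_append_right (by omega), hx]
        have := hj (c + (i - p)) (by omega) (by omega)
        rw [show c + (i - p) + p = c + i by omega] at this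
        simp [show i - p < p by omega, show i < 3 * p by omega, this]
      rcases lt_or_ge i (3 * p) with h3 | h3
      · rw [List.getElem?_append_right (by simp only [List.length_append]; omega),
          List.length_append, hx]
        have e1 := hj (c + (i - p)) (by omega) (by omega)
        have e2 := hj (c + (i - (p + p))) (by omega) (by omega)
        rw [show c + (i - p) + p = c + i by omega] at e1
        rw [show c + (i - (p + p)) + p = c + (i - p) by omega] at e2
        simp [show i - (p + p) < p by omega, show i < 3 * p by omega, e2, e1]
      · rw [List.getElem?_eq_none (by simp; omega), List.getElem?_eq_none (by simp; omega)]
  · rintro h _ ⟨s, t, rfl⟩ ⟨x, hx, rfl⟩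
    refine h s.length x.length ⟨List.length_pos_iff.2 hx, by simp; omega, fun j h1 h2 => ?_⟩
    have key : ∀ i, i < 3 * x.length →
        (s ++ (x ++ x ++ x) ++ t)[s.length + i]? = (x ++ x ++ x)[i]? := by
      intro i hi
      rw [List.append_assoc, List.getElem?_append_right (by omega),
        List.getElem?_append_left (by simp; omega)]
      simp
    obtain ⟨i, rfl⟩ := Nat.exists_eq_add_of_le h1
    rw [add_assoc, key _ (by omega), key _ (by omega)]
    exact isCube_getElem? (by omega)

lemma CubeFree.of_infix {P Q : List α} (h : CubeFree Q) (hPQ : P <:+: Q) : CubeFree P :=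
  fun c hc => h c (hc.trans hPQ)

lemma IsCube.reverse {c : List α} (h : IsCube c) : IsCube c.reverse := by
  obtain ⟨x, hx, rfl⟩ := h
  exact ⟨x.reverse, by simpa using hx, by simp⟩

lemma CubeFree.reverse {Q : List α} (h : CubeFree Q) : CubeFree Q.reverse := by
  intro c hc hcube
  refine h c.reverse ?_ hcube.reverse
  rw [← List.reverse_infix]
  simpa using hc

/-! ### Infinite words -/

/-- The infinite word `W 0, W 1, …` has no block of length `3p` with period `p`. Reversal does not
matter here, so this serves for left-infinite words as well. -/
def CubeFreeFun (W : ℕ → α) : Prop :=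
  ∀ c p, 0 < p → ¬ ∀ j, c ≤ j → j < c + 2 * p → W j = W (j + p)

lemma isCube_take {s : Stream' α} {c p : ℕ} (hp : 0 < p)
    (h : ∀ j, c ≤ j → j < c + 2 * p → s.get j = s.get (j + p)) :
    IsCube ((s.drop c).take (3 * p)) := by
  refine ⟨(s.drop c).take p, ?_, ?_⟩
  · intro h0
    have := congrArg List.length h0
    simp at this
    omega
  · have key : ∀ i, i < 2 * p → s.get (c + i) = s.get (c + i + p) :=
      fun i hi => h _ (by omega) (by omega)
    rw [show 3 * p = p + p + p by ring, Stream'.take_add, Stream'.take_add]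
    have e : ∀ k, k ≤ p → ((s.drop c).drop k).take p = ((s.drop c).drop (k + p)).take p := by
      intro k hk
      apply List.ext_getElem (by simp)
      intro i h1 h2
      simp at h1
      have := key (k + i) (by omega)
      simp only [Stream'.take_get, Stream'.get_drop]
      convert this using 2; omega
    have e1 := e 0 (by omega)
    have e2 := e p le_rfl
    simp only [zero_add, Stream'.drop_zero] at e1
    rw [← e2, ← e1]

lemma CubeFreeRightInf.cubeFreeFun {s : Stream' α} (h : CubeFreeRightInf s) :
    CubeFreeFun s.get := fun c p hp hj =>
  h _ ⟨c, by simp⟩ (isCube_take hp hj)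

lemma CubeFreeLeftInf.cubeFreeFun {s : Stream' α} (h : CubeFreeLeftInf s) :
    CubeFreeFun s.get := fun c p hp hj =>
  h ((s.drop c).take (3 * p)).reverse ⟨c, by simp⟩ (isCube_take hp hj).reverse

/-- The prefix of length `N` of `W`, with its letters listed from right to left. -/
def revPrefix (W : ℕ → α) : ℕ → List α
  | 0 => []
  | N + 1 => W N :: revPrefix W N

@[simp] lemma length_revPrefix (W : ℕ → α) (N : ℕ) : (revPrefix W N).length = N := by
  induction N with
  | zero => rfl
  | succ N ih => simp [revPrefix, ih]

lemma getElem?_revPrefix (W : ℕ → α) {N k : ℕ} (h : k < N) :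
    (revPrefix W N)[k]? = some (W (N - 1 - k)) := by
  induction N generalizing k with
  | zero => omega
  | succ N ih =>
    cases k with
    | zero => simp [revPrefix]
    | succ k =>
      simp only [revPrefix, List.getElem?_cons_succ]
      rw [ih (by omega)]
      congr 2
      omega

lemma CubeFreeFun.cubeFree_revPrefix {W : ℕ → α} (h : CubeFreeFun W) (N : ℕ) :
    CubeFree (revPrefix W N) := by
  rw [cubeFree_iff]
  rintro c p ⟨hp, hl, hj⟩
  rw [length_revPrefix] at hl
  refine h (N - c - 3 * p) p hp fun j h1 h2 => ?_
  have := hj (N - 1 - (j + p)) (by omega) (by omega)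
  rw [getElem?_revPrefix _ (by omega), getElem?_revPrefix _ (by omega)] at this
  simp only [Option.some.injEq] at this
  rw [show N - 1 - (N - 1 - (j + p)) = j + p by omega,
    show N - 1 - (N - 1 - (j + p) + p) = j by omega] at this
  exact this.symm

lemma exists_revPrefix_eq_append (W : ℕ → α) {N M : ℕ} (h : N ≤ M) :
    ∃ t : List α, t.length = M - N ∧ revPrefix W M = t ++ revPrefix W N := by
  induction M, h using Nat.le_induction with
  | base => exact ⟨[], by simp, by simp⟩
  | succ M hM ih =>
    obtain ⟨t, ht, e⟩ := ih
    exact ⟨W M :: t, by simp [ht]; omega, by simp [revPrefix, e]⟩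

lemma revPrefix_append (y : List α) (s : Stream' α) :
    revPrefix (y ++ₛ s).get y.length = y.reverse := by
  apply List.ext_getElem?
  intro i
  rcases lt_or_ge i y.length with h | h
  · rw [getElem?_revPrefix _ h, List.getElem?_reverse h, Stream'.get_append_left,
      List.getElem?_eq_getElem]
    omega
  · rw [List.getElem?_eq_none (by simpa using h), List.getElem?_eq_none (by simpa using h)]

/-! ### The potential of a word -/

/-- The number of letters that the word `z` shares with `z.drop p` before the first disagreement.
Words are read from the head, where new letters are added. -/
noncomputable def matchLen (p : ℕ) : List α → ℕ
  | [] => 0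
  | a :: t => if t[p - 1]? = some a then matchLen p t + 1 else 0

lemma matchLen_spec {p : ℕ} (hp : 0 < p) {z : List α} {k : ℕ} (hk : k < matchLen p z) :
    k + p < z.length ∧ z[k]? = z[k + p]? := by
  induction z generalizing k with
  | nil => simp [matchLen] at hk
  | cons a t ih =>
    rw [matchLen] at hk
    split_ifs at hk with h
    · obtain ⟨q, rfl⟩ : ∃ q, p = q + 1 := ⟨p - 1, by omega⟩
      cases k with
      | zero =>
        have := (List.getElem?_eq_some_iff.1 h).1
        simp only [Nat.add_sub_cancel] at h this
        refine ⟨by simp; omega, by simp [h]⟩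
      | succ k =>
        obtain ⟨h1, h2⟩ := ih (show k < matchLen (q + 1) t by omega)
        refine ⟨by simp; omega, ?_⟩
        rw [show k + 1 + (q + 1) = k + (q + 1) + 1 by omega]
        simpa using h2
    · omega

lemma le_matchLen {p : ℕ} (hp : 0 < p) {z : List α} {L : ℕ} (hL : L + p ≤ z.length)
    (h : ∀ k < L, z[k]? = z[k + p]?) : L ≤ matchLen p z := by
  induction z generalizing L with
  | nil => simp at hL; omega
  | cons a t ih =>
    cases L with
    | zero => omega
    | succ L =>
      obtain ⟨q, rfl⟩ : ∃ q, p = q + 1 := ⟨p - 1, by omega⟩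
      have h0 : t[q]? = some a := by simpa using (h 0 (by omega)).symm
      have := ih (L := L) (by simp at hL; omega) (fun k hk => by
        have := h (k + 1) (by omega)
        rw [show k + 1 + (q + 1) = k + (q + 1) + 1 by omega] at this
        simpa using this)
      rw [matchLen]
      simp [h0, this]

/-- The potential of `z` for periods up to `K`. If `m` letters agree with those `p` places before,
then `2p - m` more agreements complete a cube of period `p`; this danger is given the
weight `(5/2) ^ (m - 2p)`. -/
noncomputable def potential (K : ℕ) (z : List α) : ℝ :=
  ∑ p ∈ Icc 1 K, (5 / 2 : ℝ) ^ matchLen p z * (4 / 25) ^ p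

lemma one_le_weight {m p : ℕ} (h : 2 * p ≤ m) : 1 ≤ (5 / 2 : ℝ) ^ m * (4 / 25) ^ p := by
  calc (1 : ℝ) = (5 / 2 : ℝ) ^ (2 * p) * (4 / 25) ^ p := by
        rw [pow_mul, ← mul_pow]; norm_num
    _ ≤ _ := by gcongr; norm_num

lemma matchLen_lt_of_cubeFree {p : ℕ} (hp : 0 < p) {z : List α} (hz : CubeFree z) :
    matchLen p z < 2 * p := by
  by_contra! h
  refine cubeFree_iff.1 hz 0 p ⟨hp, ?_, fun j _ hj => (matchLen_spec hp (by omega)).2⟩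
  have := (matchLen_spec (z := z) hp (show 2 * p - 1 < _ by omega)).1
  omega

/-- A cube created by the addition of one letter is a prefix, and is seen by the potential. -/
lemma one_le_potential {K : ℕ} {a : α} {z : List α} (hz : CubeFree z)
    (ha : ¬ CubeFree (a :: z)) (hK : z.length + 1 ≤ K) : 1 ≤ potential K (a :: z) := by
  rw [cubeFree_iff] at ha
  push Not at ha
  obtain ⟨c, p, hp, hl, hj⟩ := ha
  rw [List.length_cons] at hl
  cases c with
  | succ c =>
    refine absurd ⟨hp, by omega, fun j h1 h2 => ?_⟩ (cubeFree_iff.1 hz c p)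
    have := hj (j + 1) (by omega) (by omega)
    rw [show j + 1 + p = j + p + 1 by omega] at this
    simpa using this
  | zero =>
    have h2 : 2 * p ≤ matchLen p (a :: z) :=
      le_matchLen hp (by simp; omega) fun k hk => hj k (by omega) (by omega)
    refine (one_le_weight h2).trans ?_
    exact single_le_sum (f := fun p => (5 / 2 : ℝ) ^ matchLen p (a :: z) * (4 / 25) ^ p)
      (fun _ _ => by positivity) (by simp; omega)

lemma sum_geom_le (K : ℕ) : ∑ p ∈ Icc 1 K, (4 / 25 : ℝ) ^ p ≤ 4 / 21 := by
  have h : ∑ p ∈ Icc 1 K, (4 / 25 : ℝ) ^ p = 4 / 21 * (1 - (4 / 25) ^ K) := by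
    induction K with
    | zero => simp
    | succ K ih => rw [sum_Icc_succ_top (by omega), ih]; ring
  rw [h]
  have : (0 : ℝ) ≤ (4 / 25) ^ K := by positivity
  linarith

section Finite

variable [Fintype α]

lemma sum_matchLen_cons_le (p : ℕ) (z : List α) :
    ∑ a : α, (5 / 2 : ℝ) ^ matchLen p (a :: z) ≤
      5 / 2 * (5 / 2) ^ matchLen p z + (Fintype.card α - 1) := by
  have h1 : (1 : ℝ) ≤ (5 / 2) ^ matchLen p z := one_le_pow₀ (by norm_num)
  have hc : ∑ a : α, (1 : ℝ) = Fintype.card α := by simp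
  simp only [matchLen]
  rcases hz : z[p - 1]? with _ | b
  · simp; linarith
  · have : ∀ a : α, (5 / 2 : ℝ) ^ (if some b = some a then matchLen p z + 1 else 0) =
        1 + if b = a then ((5 / 2 : ℝ) ^ (matchLen p z + 1) - 1) else 0 := by
      intro a
      by_cases h : b = a <;> simp [h]
    simp only [this, sum_add_distrib, hc, sum_ite_eq, mem_univ, if_true]
    rw [pow_succ]
    linarith

/-- A letter other than the one `p` places before resets the agreements of period `p` to `0`, so
that only the weights `(4/25) ^ p`, with sum at most `4/21`, remain. -/
lemma sum_potential_cons_le (K : ℕ) (z : List α) (hα : 1 ≤ Fintype.card α) :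
    ∑ a : α, potential K (a :: z) ≤ 5 / 2 * potential K z + (Fintype.card α - 1) * (4 / 21) := by
  have hα' : (1 : ℝ) ≤ Fintype.card α := by exact_mod_cast hα
  calc ∑ a : α, potential K (a :: z)
      = ∑ p ∈ Icc 1 K, (∑ a : α, (5 / 2 : ℝ) ^ matchLen p (a :: z)) * (4 / 25) ^ p := by
        simp only [potential]
        rw [sum_comm]
        simp only [sum_mul]
    _ ≤ ∑ p ∈ Icc 1 K, (5 / 2 * (5 / 2 : ℝ) ^ matchLen p z + (Fintype.card α - 1)) * (4 / 25) ^ p := by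
        gcongr with p _
        exact sum_matchLen_cons_le p z
    _ = 5 / 2 * potential K z + (Fintype.card α - 1) * ∑ p ∈ Icc 1 K, (4 / 25 : ℝ) ^ p := by
        simp only [potential, mul_sum, ← sum_add_distrib]
        exact sum_congr rfl fun p _ => by ring
    _ ≤ _ := by
        have := sum_geom_le K
        have : (0 : ℝ) ≤ Fintype.card α - 1 := by linarith
        gcongr

/-! ### Counting extensions -/

/-- The words `t` of length `n` such that `t ++ z` is cube-free. -/
noncomputable def extensions (n : ℕ) (z : List α) : Finset (List α) :=
  (List.finite_length_eq α n).toFinset.filter fun t => CubeFree (t ++ z)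

lemma mem_extensions {n : ℕ} {z t : List α} :
    t ∈ extensions n z ↔ t.length = n ∧ CubeFree (t ++ z) := by
  simp [extensions]

lemma sum_card_extensions_cons_le (n : ℕ) (z : List α) :
    ∑ a : α, (extensions n (a :: z)).card ≤ (extensions (n + 1) z).card := by
  rw [← card_sigma]
  refine card_le_card_of_injOn (fun x => x.2 ++ [x.1]) ?_ ?_
  · rintro ⟨a, t⟩ h
    simp only [coe_sigma, Set.mem_sigma_iff, mem_coe, mem_extensions] at h ⊢
    simpa using h.2
  · rintro ⟨a, t⟩ - ⟨b, t'⟩ - h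
    obtain ⟨h1, h2⟩ := List.append_inj' h rfl
    simp at h1 h2
    subst h1 h2
    rfl

/-- A word of potential less than `1` has exponentially many cube-free extensions. -/
lemma le_card_extensions (hα : 3 ≤ Fintype.card α) (K n : ℕ) (z : List α) (hz : CubeFree z)
    (hK : z.length + n ≤ K) :
    (5 / 2 : ℝ) ^ n * (1 - potential K z) ≤ (extensions n z).card := by
  have hα' : (3 : ℝ) ≤ Fintype.card α := by exact_mod_cast hα
  induction n generalizing z with
  | zero =>
    have h1 : (1 : ℝ) ≤ (extensions 0 z).card := by
      exact_mod_cast card_pos.2 ⟨[], mem_extensions.2 ⟨rfl, hz⟩⟩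
    have h0 : 0 ≤ potential K z := sum_nonneg fun _ _ => by positivity
    linarith
  | succ n ih =>
    have hstep : ∀ a : α, (5 / 2 : ℝ) ^ n * (1 - potential K (a :: z)) ≤
        (extensions n (a :: z)).card := by
      intro a
      by_cases ha : CubeFree (a :: z)
      · exact ih _ ha (by simp; omega)
      · have := one_le_potential hz ha (K := K) (by omega)
        have h5 : (0 : ℝ) ≤ (5 / 2) ^ n := by positivity
        have h6 : (0 : ℝ) ≤ (extensions n (a :: z)).card := by positivity
        nlinarith
    calc (5 / 2 : ℝ) ^ (n + 1) * (1 - potential K z)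
        ≤ (5 / 2 : ℝ) ^ n * ∑ a : α, (1 - potential K (a :: z)) := by
          rw [pow_succ, mul_assoc]
          gcongr
          have := sum_potential_cons_le K z (by omega)
          rw [sum_sub_distrib]
          simp only [sum_const, card_univ, nsmul_eq_mul, mul_one]
          linarith
      _ = ∑ a : α, (5 / 2 : ℝ) ^ n * (1 - potential K (a :: z)) := mul_sum _ _ _
      _ ≤ ∑ a : α, ((extensions n (a :: z)).card : ℝ) := sum_le_sum fun a _ => hstep a
      _ ≤ _ := by exact_mod_cast sum_card_extensions_cons_le n z

end Finite

/-! ### Runs in an infinite cube-free word -/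

lemma eq_of_matchLen_revPrefix {W : ℕ → α} {N p i : ℕ} (hp : 0 < p) (hi : i < N)
    (h : N ≤ i + matchLen p (revPrefix W N)) : p ≤ i ∧ W i = W (i - p) := by
  obtain ⟨h1, h2⟩ := matchLen_spec (z := revPrefix W N) hp (k := N - 1 - i) (by omega)
  rw [length_revPrefix] at h1
  rw [getElem?_revPrefix _ (by omega), getElem?_revPrefix _ h1, Option.some.injEq] at h2
  rw [show N - 1 - (N - 1 - i) = i by omega, show N - 1 - (N - 1 - i + p) = i - p by omega] at h2
  exact ⟨by omega, h2⟩

lemma matchLen_revPrefix_le (W : ℕ → α) (N : ℕ) {p : ℕ} (hp : 0 < p) :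
    matchLen p (revPrefix W N) ≤ N := by
  by_contra! h
  have := (matchLen_spec hp h).1
  rw [length_revPrefix] at this
  omega

lemma matchLen_cons_revPrefix (W : ℕ → α) (N : ℕ) (a : α) {p : ℕ} (hp : 0 < p) :
    matchLen p (a :: revPrefix W N) =
      if p ≤ N ∧ W (N - p) = a then matchLen p (revPrefix W N) + 1 else 0 := by
  rw [matchLen]
  by_cases h : p ≤ N
  · rw [getElem?_revPrefix _ (by omega), show N - 1 - (p - 1) = N - p by omega]
    simp [h]
  · rw [List.getElem?_eq_none (by simp; omega)]
    simp [h]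

/-- A run of period `p` ends just before the position `N`, and `x` lies in the interval assigned
to it. For `p ≤ 5` the interval is the whole block of agreements with the break `N`; for `p ≥ 6`
only runs of length at least `5p/2` count, and the last `p` positions are left out. -/
def Covers (W : ℕ → α) (x N p : ℕ) : Prop :=
  0 < p ∧ p ≤ N ∧ W N ≠ W (N - p) ∧ N ≤ x + matchLen p (revPrefix W N) ∧
    if p ≤ 5 then x ≤ N else 3 * p ≤ 2 * matchLen p (revPrefix W N) ∧ x + p ≤ N

lemma Covers.le {W : ℕ → α} {x N p : ℕ} (h : Covers W x N p) : x ≤ N := by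
  obtain ⟨-, -, -, -, h⟩ := h
  split_ifs at h <;> omega

/-- A run of given period whose interval contains `x` breaks at the first break after `x`. -/
lemma Covers.unique {W : ℕ → α} {x N N' p : ℕ} (h : Covers W x N p) (h' : Covers W x N' p) :
    N = N' := by
  have key : ∀ {N N'}, Covers W x N p → Covers W x N' p → ¬ N < N' := by
    rintro N N' h h' hlt
    have hx := h.le
    obtain ⟨hp, -, hb, -⟩ := h
    obtain ⟨-, -, -, hm, -⟩ := h'
    exact hb (eq_of_matchLen_revPrefix hp hlt (by omega)).2
  exact le_antisymm (not_lt.1 (key h' h)) (not_lt.1 (key h h'))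

/-- The periods at least `6` of the runs whose intervals contain a given position grow by a factor
greater than `3/2`: otherwise the overlap of two of these runs would be long enough to carry the
agreement of one past its break, or would contain a cube whose period is the difference of the
periods. -/
lemma Covers.lacunary {W : ℕ → α} (hW : CubeFreeFun W) {x N N' p q : ℕ}
    (h : Covers W x N p) (h' : Covers W x N' q) (hp : 6 ≤ p) (hpq : p < q) : 3 * p < 2 * q := by
  by_contra! hq
  obtain ⟨hp0, hpN, hb, hx, h⟩ := h
  obtain ⟨hq0, hqN, hb', hx', h'⟩ := h'
  rw [if_neg (by omega)] at h h'
  have P := fun i => eq_of_matchLen_revPrefix (W := W) (N := N) (i := i) hp0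
  have Q := fun i => eq_of_matchLen_revPrefix (W := W) (N := N') (i := i) hq0
  -- if one run breaks first, its break is undone by going through the other period and its own
  rcases lt_trichotomy N N' with hlt | rfl | hlt
  · have e1 := (Q N hlt (by omega)).2
    have e2 := (P (N - q) (by omega) (by omega)).2
    have e3 := (Q (N - p) (by omega) (by omega)).2
    rw [show N - p - q = N - q - p by omega] at e3
    exact hb (by rw [e1, e2, e3])
  · -- both periods hold for at least `3p/2 ≥ 2(q - p)` positions before `N`
    have hN := (P (N - matchLen p (revPrefix W N)) (by omega) (by omega)).1
    refine hW (N - q - 2 * (q - p)) (q - p) (by omega) fun j h1 h2 => ?_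
    have e1 := P (j + q) (by omega) (by omega)
    have e2 := Q (j + q) (by omega) (by omega)
    rw [show j + q - q = j by omega] at e2
    rw [← e2.2, e1.2]
    congr 1
    omega
  · have e1 := (P N' hlt (by omega)).2
    have e2 := (Q (N' - p) (by omega) (by omega)).2
    have e3 := (P (N' - q) (by omega) (by omega)).2
    rw [show N' - p - q = N' - q - p by omega] at e2
    exact hb' (by rw [e1, e2, e3])

/-- Comparison with the geometric series of ratio `2/3`. -/
lemma sum_inv_lacunary (A : Finset ℕ) {P : ℝ} (hP : 0 < P) (hA : ∀ p ∈ A, P ≤ p)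
    (h : ∀ p ∈ A, ∀ q ∈ A, p < q → 3 * p < 2 * q) : ∑ p ∈ A, (1 : ℝ) / p ≤ 3 / P := by
  induction A using Finset.induction_on_min generalizing P with
  | empty => simp; positivity
  | insert a s ha ih =>
    rw [sum_insert (fun h => lt_irrefl _ (ha a h))]
    have h1 : P ≤ a := hA a (mem_insert_self _ _)
    have h0 : (0 : ℝ) < a := hP.trans_le h1
    have := ih (P := 3 / 2 * a) (by positivity) (fun p hp => by
        have := h a (mem_insert_self _ _) p (mem_insert_of_mem hp) (ha p hp)
        have : (3 * a : ℝ) < 2 * p := by exact_mod_cast this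
        linarith)
      (fun p hp q hq => h p (mem_insert_of_mem hp) q (mem_insert_of_mem hq))
    calc (1 : ℝ) / a + ∑ p ∈ s, (1 : ℝ) / p ≤ 1 / a + 3 / (3 / 2 * a) := by gcongr
      _ = 3 / a := by field_simp; norm_num
      _ ≤ 3 / P := by gcongr

/-- The amount that every position in the interval of a run of period `p` receives. -/
noncomputable def share (p : ℕ) : ℝ := if p ≤ 5 then 1 / (2 * p) else 1 / p

lemma share_nonneg (p : ℕ) : 0 ≤ share p := by
  unfold share
  split_ifs <;> positivity

/-- The total amount distributed by the run of period `p` that ends just before `N`. -/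
noncomputable def charge (W : ℕ → α) (N p : ℕ) : ℝ :=
  ∑ x ∈ range (N + 1), if Covers W x N p then share p else 0

lemma charge_nonneg (W : ℕ → α) (N p : ℕ) : 0 ≤ charge W N p :=
  sum_nonneg fun _ _ => by split_ifs <;> simp [share_nonneg]

lemma sum_share_le {W : ℕ → α} (hW : CubeFreeFun W) (x M : ℕ) :
    ∑ N ∈ range M, ∑ p ∈ Icc 1 N, (if Covers W x N p then share p else 0) ≤ 197 / 120 := by
  have hnn : ∀ N p, 0 ≤ if Covers W x N p then share p else 0 := fun N p => by
    split_ifs <;> simp [share_nonneg]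
  set A := (Icc 6 M).filter fun p => ∃ N, Covers W x N p with hA
  have hinner : ∀ p, ∑ N ∈ range M, (if Covers W x N p then share p else 0) ≤
      if ∃ N, Covers W x N p then share p else 0 := by
    intro p
    split_ifs with h
    · obtain ⟨N₀, h₀⟩ := h
      calc ∑ N ∈ range M, (if Covers W x N p then share p else 0)
          ≤ ∑ N ∈ range M, (if N₀ = N then share p else 0) := by
            refine sum_le_sum fun N _ => ?_
            by_cases h : Covers W x N p
            · rw [if_pos h, if_pos (h₀.unique h)]
            · rw [if_neg h]
              split_ifs <;> simp [share_nonneg]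
        _ ≤ share p := by
            rw [sum_ite_eq]
            split_ifs <;> simp [share_nonneg]
    · push Not at h
      simp [h]
  calc ∑ N ∈ range M, ∑ p ∈ Icc 1 N, (if Covers W x N p then share p else 0)
      ≤ ∑ N ∈ range M, ∑ p ∈ Icc 1 5 ∪ Icc 6 M, (if Covers W x N p then share p else 0) := by
        refine sum_le_sum fun N hN => sum_le_sum_of_subset_of_nonneg ?_ fun p _ _ => hnn N p
        intro p hp
        simp only [mem_union, mem_Icc, mem_range] at *
        omega
    _ = ∑ p ∈ Icc 1 5 ∪ Icc 6 M, ∑ N ∈ range M, (if Covers W x N p then share p else 0) :=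
        sum_comm
    _ ≤ ∑ p ∈ Icc 1 5 ∪ Icc 6 M, (if ∃ N, Covers W x N p then share p else 0) :=
        sum_le_sum fun p _ => hinner p
    _ = ∑ p ∈ Icc 1 5, (if ∃ N, Covers W x N p then share p else 0) +
          ∑ p ∈ Icc 6 M, (if ∃ N, Covers W x N p then share p else 0) := by
        rw [sum_union]
        rw [disjoint_left]
        intro p
        simp only [mem_Icc]
        omega
    _ ≤ ∑ p ∈ Icc 1 5, share p + ∑ p ∈ A, (1 : ℝ) / p := by
        refine add_le_add (sum_le_sum fun p _ => ?_) ?_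
        · split_ifs <;> simp [share_nonneg]
        · rw [← sum_filter]
          refine sum_le_sum fun p hp => ?_
          simp only [mem_filter, mem_Icc] at hp
          rw [share, if_neg (by omega)]
    _ ≤ 137 / 120 + 3 / 6 := by
        refine add_le_add ?_ (sum_inv_lacunary A (by norm_num) ?_ ?_)
        · simp [sum_Icc_succ_top, share]
          norm_num
        · intro p hp
          simp only [hA, mem_filter, mem_Icc] at hp
          exact_mod_cast hp.1.1
        · intro p hp q hq hpq
          simp only [hA, mem_filter, mem_Icc] at hp hq
          obtain ⟨N, hN⟩ := hp.2
          obtain ⟨N', hN'⟩ := hq.2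
          exact hN.lacunary hW hN' hp.1.1 hpq
    _ = 197 / 120 := by norm_num

lemma sum_charge_le {W : ℕ → α} (hW : CubeFreeFun W) (M : ℕ) :
    ∑ N ∈ range M, ∑ p ∈ Icc 1 N, charge W N p ≤ 197 / 120 * M := by
  calc ∑ N ∈ range M, ∑ p ∈ Icc 1 N, charge W N p
      ≤ ∑ N ∈ range M, ∑ p ∈ Icc 1 N, ∑ x ∈ range M,
          (if Covers W x N p then share p else 0) := by
        refine sum_le_sum fun N hN => sum_le_sum fun p _ =>
          sum_le_sum_of_subset_of_nonneg ?_ fun x _ _ => by split_ifs <;> simp [share_nonneg]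
        simp only [mem_range] at hN
        exact range_subset_range.2 hN
    _ = ∑ N ∈ range M, ∑ x ∈ range M, ∑ p ∈ Icc 1 N,
          (if Covers W x N p then share p else 0) := sum_congr rfl fun _ _ => sum_comm
    _ = ∑ x ∈ range M, ∑ N ∈ range M, ∑ p ∈ Icc 1 N,
          (if Covers W x N p then share p else 0) := sum_comm
    _ ≤ ∑ x ∈ range M, (197 / 120 : ℝ) := sum_le_sum fun x _ => sum_share_le hW x M
    _ = _ := by simp; ring

lemma mul_share_le_charge {W : ℕ → α} {N p k l : ℕ} (hl : l ≤ N)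
    (h : ∀ x, k ≤ x → x ≤ l → Covers W x N p) : ((l + 1 - k : ℕ) : ℝ) * share p ≤ charge W N p := by
  calc ((l + 1 - k : ℕ) : ℝ) * share p = ∑ x ∈ Icc k l, share p := by simp
    _ = ∑ x ∈ Icc k l, (if Covers W x N p then share p else 0) := by
        refine sum_congr rfl fun x hx => ?_
        rw [mem_Icc] at hx
        rw [if_pos (h x hx.1 hx.2)]
    _ ≤ charge W N p := by
        refine sum_le_sum_of_subset_of_nonneg ?_ fun x _ _ => by split_ifs <;> simp [share_nonneg]
        intro x hx
        simp only [mem_Icc, mem_range] at *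
        omega

lemma le_charge_of_le_five {W : ℕ → α} {N p : ℕ} (hp : 0 < p) (hpN : p ≤ N)
    (hb : W N ≠ W (N - p)) (h5 : p ≤ 5) :
    ((matchLen p (revPrefix W N) : ℝ) + 1) / (2 * p) ≤ charge W N p := by
  have hm := matchLen_revPrefix_le W N hp
  have := mul_share_le_charge (W := W) (N := N) (p := p)
    (k := N - matchLen p (revPrefix W N)) (l := N) le_rfl
    (fun x h1 h2 => ⟨hp, hpN, hb, by omega, by rwa [if_pos h5]⟩)
  rw [show N + 1 - (N - matchLen p (revPrefix W N)) = matchLen p (revPrefix W N) + 1 by omega,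
    share, if_pos h5] at this
  push_cast at this
  rwa [mul_one_div] at this

lemma le_charge_of_six_le {W : ℕ → α} {N p : ℕ} (hpN : p ≤ N)
    (hb : W N ≠ W (N - p)) (h6 : 6 ≤ p) (hm : 3 * p ≤ 2 * matchLen p (revPrefix W N)) :
    ((matchLen p (revPrefix W N) : ℝ) + 1 - p) / p ≤ charge W N p := by
  have hmN := matchLen_revPrefix_le W N (p := p) (by omega)
  have := mul_share_le_charge (W := W) (N := N) (p := p)
    (k := N - matchLen p (revPrefix W N)) (l := N - p) (by omega)
    (fun x h1 h2 => ⟨by omega, hpN, hb, by omega, by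
      rw [if_neg (by omega)]; exact ⟨hm, by omega⟩⟩)
  rw [show N - p + 1 - (N - matchLen p (revPrefix W N)) = matchLen p (revPrefix W N) + 1 - p
    by omega, share, if_neg (by omega), Nat.cast_sub (by omega)] at this
  push_cast at this
  rwa [mul_one_div] at this

/-! ### A deviation of small potential -/

lemma weight_eq {m e p : ℕ} (h : m + 1 + e = 2 * p) :
    (5 / 2 : ℝ) ^ (m + 1) * (4 / 25) ^ p = (2 / 5) ^ e := by
  rw [show (4 / 25 : ℝ) = (2 / 5) ^ 2 by norm_num, ← pow_mul, ← h,
    pow_add (2 / 5 : ℝ), ← mul_assoc, ← mul_pow]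
  norm_num

lemma weight_le_of_le_five {m p : ℕ} (hp : 0 < p) (h5 : p ≤ 5) (hm : m + 2 ≤ 2 * p) :
    (5 / 2 : ℝ) ^ (m + 1) * (4 / 25) ^ p ≤ (4 / 25) ^ p + 1 / 2 * (((m : ℝ) + 1) / (2 * p)) := by
  have hm8 : m ≤ 8 := by omega
  interval_cases p <;> interval_cases m <;> first | omega | norm_num

lemma weight_le_of_six_le {m p : ℕ} (h6 : 6 ≤ p) (hm : m + 2 ≤ 2 * p) (h3 : 3 * p ≤ 2 * m) :
    (5 / 2 : ℝ) ^ (m + 1) * (4 / 25) ^ p ≤ 1 / 2 * (((m : ℝ) + 1 - p) / p) := by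
  obtain ⟨e, he⟩ : ∃ e, m + 1 + e = 2 * p := ⟨2 * p - (m + 1), by omega⟩
  have hp : (6 : ℝ) ≤ p := by exact_mod_cast h6
  have h3' : (3 * p : ℝ) ≤ 2 * m := by exact_mod_cast h3
  have he' : (m + 1 + e : ℝ) = 2 * p := by exact_mod_cast he
  rw [weight_eq he, mul_div_assoc', le_div_iff₀ (by linarith)]
  obtain rfl | h2 : e = 1 ∨ 2 ≤ e := by omega
  · push_cast at he'
    linarith
  · have : (2 / 5 : ℝ) ^ e ≤ (2 / 5) ^ 2 := pow_le_pow_of_le_one (by norm_num) (by norm_num) h2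
    nlinarith

lemma weight_le_of_short {m p : ℕ} (h3 : 2 * m < 3 * p) (hm : m + 1 ≤ 2 * p) :
    (5 / 2 : ℝ) ^ (m + 1) * (4 / 25) ^ p ≤ (2 / 5) ^ (p / 2) := by
  obtain ⟨e, he⟩ : ∃ e, m + 1 + e = 2 * p := ⟨2 * p - (m + 1), by omega⟩
  rw [weight_eq he]
  exact pow_le_pow_of_le_one (by norm_num) (by norm_num) (by omega)

/-- A bound for the contribution of the period `p` to the potential when no run of period `p` is
charged for it. -/
noncomputable def baseWeight (p : ℕ) : ℝ := if p ≤ 5 then (4 / 25) ^ p else (2 / 5) ^ (p / 2)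

lemma sum_baseWeight_le (K : ℕ) : ∑ p ∈ Icc 1 K, baseWeight p ≤ 49 / 100 := by
  have hnn : ∀ p, 0 ≤ baseWeight p := fun p => by unfold baseWeight; split_ifs <;> positivity
  have h : ∀ k : ℕ, ∑ p ∈ Icc 1 (5 + 2 * k), baseWeight p =
      ∑ p ∈ Icc 1 5, (4 / 25 : ℝ) ^ p + 16 / 75 * (1 - (2 / 5) ^ k) := by
    intro k
    induction k with
    | zero =>
      simp only [mul_zero, add_zero, pow_zero, sub_self]
      refine sum_congr rfl fun p hp => ?_
      rw [baseWeight, if_pos (mem_Icc.1 hp).2]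
    | succ k ih =>
      rw [show 5 + 2 * (k + 1) = 5 + 2 * k + 1 + 1 by ring, sum_Icc_succ_top (by omega),
        sum_Icc_succ_top (by omega), ih, baseWeight, if_neg (by omega), baseWeight,
        if_neg (by omega), show (5 + 2 * k + 1) / 2 = k + 3 by omega,
        show (5 + 2 * k + 1 + 1) / 2 = k + 3 by omega]
      ring
  calc ∑ p ∈ Icc 1 K, baseWeight p ≤ ∑ p ∈ Icc 1 (5 + 2 * K), baseWeight p :=
        sum_le_sum_of_subset_of_nonneg (Icc_subset_Icc_right (by omega)) fun p _ _ => hnn p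
    _ ≤ 4 / 21 + 16 / 75 := by
        rw [h]
        have := sum_geom_le 5
        have : (0 : ℝ) ≤ (2 / 5) ^ K := by positivity
        linarith
    _ ≤ 49 / 100 := by norm_num

/-- If the letter `a` at the position `N` leads to a large potential, then the runs that end there
and would be continued by `a` carry a total charge of at least `1`. -/
lemma one_le_sum_charge {W : ℕ → α} {N K : ℕ} {a : α} (ha : a ≠ W N)
    (hK : 99 / 100 ≤ potential K (a :: revPrefix W N)) :
    1 ≤ ∑ p ∈ (Icc 1 N).filter (fun p => W (N - p) = a), charge W N p := by
  set F := (Icc 1 N).filter (fun p => W (N - p) = a) with hF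
  have hmem : ∀ p, p ∈ F ↔ 0 < p ∧ p ≤ N ∧ W (N - p) = a := fun p => by
    simp [hF, Nat.succ_le_iff, and_assoc]
  have hnn : ∀ p ∈ F, 0 ≤ charge W N p := fun p _ => charge_nonneg W N p
  by_cases hfull : ∃ p ∈ F, 2 * p ≤ matchLen p (revPrefix W N) + 1
  · -- a cube is one letter short of completion
    obtain ⟨p, hpF, hm⟩ := hfull
    refine le_trans ?_ (single_le_sum hnn hpF)
    obtain ⟨hp, hpN, hpa⟩ := (hmem p).1 hpF
    have hb : W N ≠ W (N - p) := by rw [hpa]; exact ha.symm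
    have hp' : (0 : ℝ) < p := by exact_mod_cast hp
    have hm' : (2 * p : ℝ) ≤ matchLen p (revPrefix W N) + 1 := by exact_mod_cast hm
    rcases le_or_gt p 5 with h5 | h5
    · refine le_trans ?_ (le_charge_of_le_five hp hpN hb h5)
      rw [le_div_iff₀ (by positivity)]
      linarith
    · refine le_trans ?_ (le_charge_of_six_le hpN hb h5 (by omega))
      rw [le_div_iff₀ (by positivity)]
      linarith
  push Not at hfull
  have hbound : ∀ p ∈ Icc 1 K, (5 / 2 : ℝ) ^ matchLen p (a :: revPrefix W N) * (4 / 25) ^ p ≤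
      baseWeight p + if p ∈ F then 1 / 2 * charge W N p else 0 := by
    intro p hp
    have hp : 0 < p := (mem_Icc.1 hp).1
    rw [matchLen_cons_revPrefix W N a hp]
    by_cases hpF : p ∈ F
    · have hm := hfull p hpF
      rw [if_pos ((hmem p).1 hpF).2, if_pos hpF]
      obtain ⟨-, hpN, hpa⟩ := (hmem p).1 hpF
      have hb : W N ≠ W (N - p) := by rw [hpa]; exact ha.symm
      rw [baseWeight]
      split_ifs with h5
      · have := weight_le_of_le_five hp h5 (m := matchLen p (revPrefix W N)) (by omega)
        have := le_charge_of_le_five hp hpN hb h5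
        linarith
      · rcases lt_or_ge (2 * matchLen p (revPrefix W N)) (3 * p) with h3 | h3
        · have := weight_le_of_short h3 (by omega)
          have := charge_nonneg W N p
          linarith
        · have := weight_le_of_six_le (by omega) (by omega) h3
          have := le_charge_of_six_le hpN hb (by omega) h3
          have : (0 : ℝ) ≤ (2 / 5) ^ (p / 2) := by positivity
          linarith
    · rw [if_neg fun h => hpF ((hmem p).2 ⟨hp, h⟩), if_neg hpF, baseWeight]
      split_ifs
      · simp
      · rw [show (4 / 25 : ℝ) = (2 / 5) ^ 2 by norm_num, ← pow_mul, pow_zero, one_mul, add_zero]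
        exact pow_le_pow_of_le_one (by norm_num) (by norm_num) (by omega)
  have hsum : ∑ p ∈ Icc 1 K, (if p ∈ F then 1 / 2 * charge W N p else 0) ≤
      1 / 2 * ∑ p ∈ F, charge W N p := by
    rw [← sum_filter, mul_sum]
    refine sum_le_sum_of_subset_of_nonneg (fun p hp => (mem_filter.1 hp).2) fun p hp _ => ?_
    have := hnn p hp
    positivity
  have := (sum_le_sum hbound).trans_eq sum_add_distrib
  have := sum_baseWeight_le K
  unfold potential at hK
  linarith

section Finite

variable [Fintype α]

/-- Along an infinite cube-free word there is, after any position, a place where the next letter can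
be changed so that the potential becomes less than `99/100`. Otherwise two letters carry a charge
of at least `1` each at almost every place, but the average charge is at most `197/120 < 2`. -/
lemma exists_small_potential (hα : 3 ≤ Fintype.card α) {W : ℕ → α} (hW : CubeFreeFun W)
    (N₀ : ℕ) : ∃ N, N₀ ≤ N ∧ ∃ a : α, CubeFree (a :: revPrefix W N) ∧
      ∀ K, potential K (a :: revPrefix W N) < 99 / 100 := by
  by_contra! hcon
  have hcharge : ∀ N, N₀ ≤ N → ∀ a, a ≠ W N →
      1 ≤ ∑ p ∈ (Icc 1 N).filter (fun p => W (N - p) = a), charge W N p := by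
    intro N hN a ha
    by_cases hcf : CubeFree (a :: revPrefix W N)
    · obtain ⟨K, hK⟩ := hcon N hN a hcf
      exact one_le_sum_charge ha hK
    · have := one_le_potential (hW.cubeFree_revPrefix N) hcf le_rfl
      exact one_le_sum_charge ha (le_trans (by norm_num) this)
  have htwo : ∀ N, N₀ ≤ N → 2 ≤ ∑ p ∈ Icc 1 N, charge W N p := by
    intro N hN
    obtain ⟨a, ha, b, hb, hab⟩ : ∃ a ∈ univ.erase (W N), ∃ b ∈ univ.erase (W N), a ≠ b := by
      rw [← one_lt_card, card_erase_of_mem (mem_univ _), card_univ]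
      omega
    have hdisj : Disjoint ((Icc 1 N).filter fun p => W (N - p) = a)
        ((Icc 1 N).filter fun p => W (N - p) = b) := by
      rw [disjoint_left]
      intro p h1 h2
      exact hab ((mem_filter.1 h1).2.symm.trans (mem_filter.1 h2).2)
    have := hcharge N hN a (ne_of_mem_erase ha)
    have := hcharge N hN b (ne_of_mem_erase hb)
    calc (2 : ℝ) ≤ _ := by linarith
      _ = _ := (sum_union hdisj).symm
      _ ≤ _ := sum_le_sum_of_subset_of_nonneg
        (union_subset (filter_subset _ _) (filter_subset _ _)) fun p _ _ => charge_nonneg W N p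
  -- beyond `N₀` there are `5N₀ + 6` positions, and `2(5N₀ + 6) > (197/120) · 6(N₀ + 1)`
  have hup := sum_charge_le hW (6 * (N₀ + 1))
  have hlow : (2 : ℝ) * (5 * N₀ + 6 : ℕ) ≤
      ∑ N ∈ range (6 * (N₀ + 1)), ∑ p ∈ Icc 1 N, charge W N p := by
    calc (2 : ℝ) * (5 * N₀ + 6 : ℕ) = ∑ N ∈ Ico N₀ (6 * (N₀ + 1)), (2 : ℝ) := by
          rw [sum_const, Nat.card_Ico, show 6 * (N₀ + 1) - N₀ = 5 * N₀ + 6 by omega, nsmul_eq_mul,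
            mul_comm]
      _ ≤ ∑ N ∈ Ico N₀ (6 * (N₀ + 1)), ∑ p ∈ Icc 1 N, charge W N p :=
          sum_le_sum fun N hN => htwo N (mem_Ico.1 hN).1
      _ ≤ _ := sum_le_sum_of_subset_of_nonneg
          (fun N hN => mem_range.2 (mem_Ico.1 hN).2)
          fun N _ _ => sum_nonneg fun p _ => charge_nonneg W N p
  push_cast at hup hlow
  have : (0 : ℝ) ≤ N₀ := by positivity
  linarith

/-- A word that extends to an infinite cube-free word has at least `c (5/2) ^ n` cube-free
extensions by `n` letters. -/
lemma exists_le_card_extensions (hα : 3 ≤ Fintype.card α) {W : ℕ → α} (hW : CubeFreeFun W)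
    (N₀ : ℕ) : ∃ c : ℝ, 0 < c ∧ ∃ n₀, ∀ n, n₀ ≤ n →
      c * (5 / 2) ^ n ≤ (extensions n (revPrefix W N₀)).card := by
  obtain ⟨N, hN, a, hcf, hpot⟩ := exists_small_potential hα hW N₀
  obtain ⟨t, ht, e⟩ := exists_revPrefix_eq_append W hN
  refine ⟨1 / 100 * (2 / 5) ^ (N - N₀ + 1), by positivity, N - N₀ + 1, fun n hn => ?_⟩
  obtain ⟨k, rfl⟩ := Nat.exists_eq_add_of_le hn
  have h1 := le_card_extensions hα _ k _ hcf le_rfl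
  have h2 : (extensions k (a :: revPrefix W N)).card ≤
      (extensions (N - N₀ + 1 + k) (revPrefix W N₀)).card := by
    refine card_le_card_of_injOn (fun s => s ++ (a :: t)) (fun s hs => ?_) ?_
    · simp only [mem_coe, mem_extensions] at hs ⊢
      refine ⟨by simp [ht, hs.1]; omega, ?_⟩
      rw [e] at hs
      simpa using hs.2
    · intro s _ s' _ h
      exact List.append_cancel_right h
  calc 1 / 100 * (2 / 5 : ℝ) ^ (N - N₀ + 1) * (5 / 2) ^ (N - N₀ + 1 + k)
      = (5 / 2) ^ k * (1 / 100) := by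
        rw [pow_add _ (N - N₀ + 1) k, mul_assoc, ← mul_assoc ((2 / 5 : ℝ) ^ (N - N₀ + 1)),
          ← mul_pow]
        norm_num
        ring
    _ ≤ _ := by
        have := hpot ((a :: revPrefix W N).length + k)
        gcongr
        linarith
    _ ≤ _ := h1
    _ ≤ _ := by exact_mod_cast h2

end Finite

/-! ### Joining two extensions -/

/-- A cube is determined by any of its parts that arise by removing a window of two periods. -/
lemma eq_of_cubeAt {Q Q' : List α} {c p k : ℕ} (h : CubeAt Q c p) (h' : CubeAt Q' c p)
    (hk : c ≤ k) (hk' : k ≤ c + p) (hout : ∀ j, j < k ∨ k + 2 * p ≤ j → Q[j]? = Q'[j]?) :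
    Q = Q' := by
  obtain ⟨hp, hl, hj⟩ := h
  obtain ⟨-, hl', hj'⟩ := h'
  have h1 : ∀ j, c ≤ j → j < c + p → Q[j]? = Q'[j]? := by
    intro j h1 h2
    rcases lt_or_ge j k with h3 | h3
    · exact hout j (Or.inl h3)
    · rw [hj j h1 (by omega), hj (j + p) (by omega) (by omega), hj' j h1 (by omega),
        hj' (j + p) (by omega) (by omega)]
      exact hout _ (Or.inr (by omega))
  have h2 : ∀ j, c ≤ j → j < c + 2 * p → Q[j]? = Q'[j]? := by
    intro j h2 h3
    rcases lt_or_ge j (c + p) with h4 | h4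
    · exact h1 j h2 h4
    · have e := hj (j - p) (by omega) (by omega)
      have e' := hj' (j - p) (by omega) (by omega)
      rw [Nat.sub_add_cancel (by omega)] at e e'
      rw [← e, ← e']
      exact h1 _ (by omega) (by omega)
  apply List.ext_getElem?
  intro j
  by_cases h3 : j < k ∨ k + 2 * p ≤ j
  · exact hout j h3
  push Not at h3
  rcases lt_or_ge j (c + 2 * p) with h4 | h4
  · exact h2 j (by omega) h4
  · have e := hj (j - p) (by omega) (by omega)
    have e' := hj' (j - p) (by omega) (by omega)
    rw [Nat.sub_add_cancel (by omega)] at e e'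
    rw [← e, ← e']
    exact h2 _ (by omega) (by omega)

/-- The word obtained from `y` and `z` (both with their heads at the junction) by inserting the
extensions `s` of `y` and `t` of `z`. -/
def joined (y z s t : List α) : List α := (s ++ y).reverse ++ (t ++ z)

lemma getElem?_joined_left {y z s t : List α} {n i : ℕ} (hs : s.length = n) (hi : i < n + y.length) :
    (joined y z s t)[i]? = (s ++ y)[n + y.length - 1 - i]? := by
  rw [joined, List.getElem?_append_left (by simp; omega), List.getElem?_reverse (by simp; omega)]
  simp [hs]

lemma getElem?_joined_right {y z s t : List α} {n i : ℕ} (hs : s.length = n)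
    (hi : n + y.length ≤ i) : (joined y z s t)[i]? = (t ++ z)[i - (n + y.length)]? := by
  rw [joined, List.getElem?_append_right (by simp; omega), List.length_reverse,
    List.length_append, hs]

/-- A cube in a joined word crosses the junction. -/
lemma CubeAt.crosses {y z s t : List α} (hs : CubeFree (s ++ y)) (ht : CubeFree (t ++ z))
    {c p : ℕ} (h : CubeAt (joined y z s t) c p) :
    c < (s ++ y).length ∧ (s ++ y).length < c + 3 * p := by
  by_contra! hcon
  obtain ⟨hp, hl, hj⟩ := h
  have hlen : (joined y z s t).length = (s ++ y).length + (t ++ z).length := by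
    rw [joined, List.length_append, List.length_reverse]
  rcases lt_or_ge c (s ++ y).length with h1 | h1
  · refine cubeFree_iff.1 hs.reverse c p ⟨hp, ?_, fun j h2 h3 => ?_⟩
    · rw [List.length_reverse]; exact hcon h1
    · have := hcon h1
      have := hj j h2 h3
      rwa [joined, List.getElem?_append_left (by rw [List.length_reverse]; omega),
        List.getElem?_append_left (by rw [List.length_reverse]; omega)] at this
  · refine cubeFree_iff.1 ht (c - (s ++ y).length) p ⟨hp, by omega, fun j h2 h3 => ?_⟩
    have hright : ∀ i, (joined y z s t)[i + (s ++ y).length]? = (t ++ z)[i]? := fun i => by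
      rw [joined, List.getElem?_append_right (by rw [List.length_reverse]; omega),
        List.length_reverse, Nat.add_sub_cancel]
    have := hj (j + (s ++ y).length) (by omega) (by omega)
    rwa [hright, show j + (s ++ y).length + p = j + p + (s ++ y).length by omega, hright] at this

section Finite

variable [Fintype α]

/-- The pairs of extensions of `y` and `z` whose joined word carries a cube in a given place are
determined by what remains after the removal of `2p` letters around the junction. -/
lemma card_cubeAt_le (y z : List α) {n m c p k l : ℕ} (hkn : k ≤ n) (hlm : l ≤ m)
    (hkl : k + l = 2 * p) (hc : c + k ≤ n + y.length) (hc' : n + y.length + l ≤ c + 3 * p) :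
    ((extensions n y ×ˢ extensions m z).filter fun x => CubeAt (joined y z x.1 x.2) c p).card ≤
      (extensions (n - k) y).card * (extensions (m - l) z).card := by
  rw [← card_product]
  refine card_le_card_of_injOn (fun x => (x.1.drop k, x.2.drop l)) ?_ ?_
  · rintro ⟨s, t⟩ h
    simp only [coe_filter, mem_product, Set.mem_ofPred_eq, mem_extensions] at h
    obtain ⟨⟨⟨hs, hsy⟩, ht, htz⟩, -⟩ := h
    simp only [coe_product, Set.mem_prod, mem_coe, mem_extensions]
    refine ⟨⟨by simp [hs], hsy.of_infix ?_⟩, by simp [ht], htz.of_infix ?_⟩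
    · rw [← List.drop_append_of_le_length (by omega)]
      exact (List.drop_suffix _ _).isInfix
    · rw [← List.drop_append_of_le_length (by omega)]
      exact (List.drop_suffix _ _).isInfix
  · rintro ⟨s, t⟩ h ⟨s', t'⟩ h' heq
    simp only [coe_filter, mem_product, Set.mem_ofPred_eq, mem_extensions] at h h'
    obtain ⟨⟨⟨hs, -⟩, ht, -⟩, hcube⟩ := h
    obtain ⟨⟨⟨hs', -⟩, ht', -⟩, hcube'⟩ := h'
    simp only [Prod.mk.injEq] at heq
    have key : joined y z s t = joined y z s' t' := by
      refine eq_of_cubeAt hcube hcube' (k := n + y.length - k) (by omega) (by omega) fun j hj => ?_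
      rcases hj with hj | hj
      · have hd : ∀ r : List α, r.length = n → (joined y z r t)[j]? =
            (r.drop k ++ y)[n + y.length - 1 - j - k]? := by
          intro r hr
          rw [getElem?_joined_left hr (by omega), ← List.drop_append_of_le_length (by omega),
            List.getElem?_drop]
          congr 1
          omega
        have e : (joined y z s' t')[j]? = (joined y z s' t)[j]? := by
          rw [getElem?_joined_left hs' (by omega), getElem?_joined_left hs' (by omega)]
        rw [e, hd s hs, hd s' hs', heq.1]
      · rw [getElem?_joined_right hs (by omega), getElem?_joined_right hs' (by omega)]
        have hd : ∀ r : List α, r.length = m → (r ++ z)[j - (n + y.length)]? =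
            (r.drop l ++ z)[j - (n + y.length) - l]? := by
          intro r hr
          rw [← List.drop_append_of_le_length (by omega), List.getElem?_drop]
          congr 1
          omega
        rw [hd t ht, hd t' ht', heq.2]
    obtain ⟨h1, h2⟩ := List.append_inj key (by simp [hs, hs'])
    have h1 := List.reverse_injective h1
    rw [List.append_cancel_right h1, List.append_cancel_right h2]

/-- The length `n` is a record for the growth of the extensions of `z` relative to `(9/4) ^ n`. -/
def IsRecord (z : List α) (n : ℕ) : Prop :=
  0 < (extensions n z).card ∧ ∀ k, k ≤ n →
    ((extensions (n - k) z).card : ℝ) ≤ (4 / 9) ^ k * (extensions n z).card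

/-- Growth at the rate `5/2` produces arbitrarily large records relative to the rate `9/4`. -/
lemma exists_isRecord {z : List α} {c : ℝ} (hc : 0 < c) {n₀ : ℕ}
    (h : ∀ n, n₀ ≤ n → c * (5 / 2) ^ n ≤ (extensions n z).card) (L : ℕ) :
    ∃ n, L ≤ n ∧ IsRecord z n := by
  set f : ℕ → ℝ := fun n => (extensions n z).card * (4 / 9) ^ n with hf
  have hlow : ∀ n, n₀ ≤ n → c * (10 / 9) ^ n ≤ f n := by
    intro n hn
    calc c * (10 / 9 : ℝ) ^ n = c * (5 / 2) ^ n * (4 / 9) ^ n := by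
          rw [mul_assoc, ← mul_pow]; norm_num
      _ ≤ _ := by
          have := h n hn
          simp only [hf]
          gcongr
  -- a value of `f` beyond all values up to `L`, and then the maximum of `f` up to that place
  obtain ⟨B, hB⟩ : ∃ B : ℝ, ∀ n, n < L → f n ≤ B :=
    ⟨∑ n ∈ range L, f n, fun n hn => single_le_sum (f := f)
      (fun _ _ => by simp only [hf]; positivity) (mem_range.2 hn)⟩
  obtain ⟨M, hM⟩ := pow_unbounded_of_one_lt (B / c) (show (1 : ℝ) < 10 / 9 by norm_num)
  obtain ⟨n, hn, hmax⟩ := exists_max_image (range (max M n₀ + 1)) f ⟨0, by simp⟩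
  have hbig : max 0 B < f n := by
    have h1 : c * (10 / 9) ^ max M n₀ ≤ f (max M n₀) := hlow _ (le_max_right _ _)
    have h2 : f (max M n₀) ≤ f n := hmax _ (by simp)
    have h3 : (10 / 9 : ℝ) ^ M ≤ (10 / 9) ^ max M n₀ :=
      pow_le_pow_right₀ (by norm_num) (le_max_left _ _)
    have h4 : B < c * (10 / 9) ^ max M n₀ := by
      rw [div_lt_iff₀ hc] at hM
      nlinarith
    have h5 : 0 < c * (10 / 9 : ℝ) ^ max M n₀ := by positivity
    exact max_lt (by linarith) (by linarith)
  refine ⟨n, ?_, ?_, fun k hk => ?_⟩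
  · by_contra! hlt
    have := hB n hlt
    have := le_max_right 0 B
    linarith
  · by_contra! h0
    have h0 : (extensions n z).card = 0 := by omega
    have : f n = 0 := by simp [hf, h0]
    have := le_max_left 0 B
    linarith
  · have h1 := hmax (n - k) (by simp at hn ⊢; omega)
    simp only [hf] at h1
    have e : (4 / 9 : ℝ) ^ n = (4 / 9) ^ k * (4 / 9) ^ (n - k) := by
      rw [← pow_add]; congr 1; omega
    rw [e, ← mul_assoc] at h1
    have := le_of_mul_le_mul_right h1 (by positivity)
    linarith

/-- The proportion of pairs lost to cubes across the junction; `16/81 = (4/9) ^ 2`. -/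
lemma sum_crossing_lt (K : ℕ) : ∑ p ∈ Icc 1 K, (3 * p : ℝ) * (16 / 81) ^ p < 1 := by
  have h : ∑ p ∈ Icc 1 K, (3 * p : ℝ) * (1 / 5) ^ p =
      15 / 16 - (3 / 4 * K + 15 / 16) * (1 / 5) ^ K := by
    induction K with
    | zero => norm_num
    | succ K ih => rw [sum_Icc_succ_top (by omega), ih]; push_cast; ring
  calc ∑ p ∈ Icc 1 K, (3 * p : ℝ) * (16 / 81) ^ p ≤ ∑ p ∈ Icc 1 K, (3 * p : ℝ) * (1 / 5) ^ p := by
        refine sum_le_sum fun p _ => mul_le_mul_of_nonneg_left ?_ (by positivity)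
        exact pow_le_pow_left₀ (by norm_num) (by norm_num) p
    _ < 1 := by
        rw [h]
        have : 0 ≤ (3 / 4 * K + 15 / 16) * (1 / 5 : ℝ) ^ K := by positivity
        linarith

/-- Record extensions of two words can be joined. -/
lemma exists_cubeFree_joined {y z : List α} {n m : ℕ} (hn : IsRecord y n) (hm : IsRecord z m)
    (hyn : 3 * (y.length + z.length) ≤ n) (hzm : 3 * (y.length + z.length) ≤ m) :
    ∃ s t, CubeFree (joined y z s t) := by
  by_contra! hcon
  set E := extensions n y ×ˢ extensions m z with hE
  set b := n + y.length with hb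
  set K := b + (m + z.length) with hK
  -- there are at most `3p` places for a cube of period `p` that crosses the junction
  have hbad : ∀ p ∈ Icc 1 K, ∀ c ∈ Ico (b - 3 * p) b,
      ((E.filter fun x => CubeAt (joined y z x.1 x.2) c p).card : ℝ) ≤
        (16 / 81) ^ p * E.card := by
    intro p hp c hc
    rw [mem_Icc] at hp
    rw [mem_Ico] at hc
    rcases lt_or_ge K (c + 3 * p) with hlong | hlong
    · rw [filter_eq_empty_iff.2, card_empty, Nat.cast_zero]
      · positivity
      · rintro ⟨s, t⟩ hst ⟨-, hl, -⟩
        simp only [hE, mem_product, mem_extensions] at hst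
        simp [joined] at hl
        omega
    obtain ⟨k, l, hkn, hlm, hkl, h1, h2⟩ : ∃ k l, k ≤ n ∧ l ≤ m ∧ k + l = 2 * p ∧
        c + k ≤ b ∧ b + l ≤ c + 3 * p := by
      -- as many letters as possible are removed on the side of `y`
      refine ⟨min (min n (b - c)) (2 * p), 2 * p - min (min n (b - c)) (2 * p), ?_⟩
      omega
    have h3 : ((E.filter fun x => CubeAt (joined y z x.1 x.2) c p).card : ℝ) ≤
        (extensions (n - k) y).card * (extensions (m - l) z).card := by
      exact_mod_cast card_cubeAt_le y z hkn hlm hkl h1 h2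
    refine h3.trans ?_
    have h4 := hn.2 k hkn
    have h5 := hm.2 l hlm
    calc ((extensions (n - k) y).card : ℝ) * (extensions (m - l) z).card
        ≤ ((4 / 9) ^ k * (extensions n y).card) * ((4 / 9) ^ l * (extensions m z).card) := by
          gcongr
      _ = (4 / 9) ^ (k + l) * E.card := by
          rw [hE, card_product, pow_add]; push_cast; ring
      _ = _ := by rw [hkl, pow_mul]; norm_num
  have hcover : E ⊆ (Icc 1 K).biUnion fun p => (Ico (b - 3 * p) b).biUnion fun c =>
      E.filter fun x => CubeAt (joined y z x.1 x.2) c p := by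
    rintro ⟨s, t⟩ hst
    have hst' := hst
    simp only [hE, mem_product, mem_extensions] at hst'
    have h0 := hcon s t
    rw [cubeFree_iff] at h0
    push Not at h0
    obtain ⟨c, p, h⟩ := h0
    obtain ⟨h1, h2⟩ := h.crosses hst'.1.2 hst'.2.2
    have hl := h.2.1
    have hp := h.1
    simp only [List.length_append] at h1 h2
    simp [joined] at hl
    simp only [mem_biUnion, mem_filter, mem_Icc, mem_Ico]
    exact ⟨p, ⟨hp, by omega⟩, c, ⟨by omega, by omega⟩, hst, h⟩
  have hpos : (0 : ℝ) < E.card := by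
    rw [hE, card_product]
    exact_mod_cast Nat.mul_pos hn.1 hm.1
  have hcard : (E.card : ℝ) ≤ (∑ p ∈ Icc 1 K, (3 * p : ℝ) * (16 / 81) ^ p) * E.card := by
    calc (E.card : ℝ) ≤ ∑ p ∈ Icc 1 K, ∑ c ∈ Ico (b - 3 * p) b,
          ((E.filter fun x => CubeAt (joined y z x.1 x.2) c p).card : ℝ) := by
          have h1 := (card_le_card hcover).trans
            (card_biUnion_le.trans (sum_le_sum fun p _ => card_biUnion_le))
          exact_mod_cast h1
      _ ≤ ∑ p ∈ Icc 1 K, ∑ c ∈ Ico (b - 3 * p) b, ((16 / 81) ^ p * E.card : ℝ) :=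
          sum_le_sum fun p hp => sum_le_sum fun c hc => hbad p hp c hc
      _ ≤ ∑ p ∈ Icc 1 K, (3 * p : ℝ) * (16 / 81) ^ p * E.card := by
          refine sum_le_sum fun p _ => ?_
          rw [sum_const, Nat.card_Ico, nsmul_eq_mul, mul_assoc]
          have : ((b - (b - 3 * p) : ℕ) : ℝ) ≤ 3 * p := by
            exact_mod_cast (show b - (b - 3 * p) ≤ 3 * p by omega)
          gcongr
      _ = _ := (sum_mul _ _ _).symm
  have := sum_crossing_lt K
  nlinarith

end Finite

end CubeFreeWords

theorem theorem3 (d : ℕ) (hd : 3 ≤ d) (u v : List (Fin d))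
    (hu : CubeFreeWords.CubeFree u) (hv : CubeFreeWords.CubeFree v)
    (hur : CubeFreeWords.RightExtendable u) (hvl : CubeFreeWords.LeftExtendable v) :
    ∃ w : List (Fin d), CubeFreeWords.CubeFree (u ++ w ++ v) := by
  obtain ⟨r, hr⟩ := hur
  obtain ⟨l, hl⟩ := hvl
  have hα : 3 ≤ Fintype.card (Fin d) := by simpa using hd
  obtain ⟨c, hc, n₀, h⟩ := CubeFreeWords.exists_le_card_extensions hα hr.cubeFreeFun u.length
  obtain ⟨c', hc', m₀, h'⟩ := CubeFreeWords.exists_le_card_extensions hα hl.cubeFreeFun v.reverse.length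
  rw [CubeFreeWords.revPrefix_append] at h h'
  -- the left-infinite word is read from right to left, so `v` itself has its head at the growing end
  rw [List.reverse_reverse] at h'
  obtain ⟨n, hn, hn'⟩ := CubeFreeWords.exists_isRecord hc h (3 * (u.reverse.length + v.length))
  obtain ⟨m, hm, hm'⟩ := CubeFreeWords.exists_isRecord hc' h' (3 * (u.reverse.length + v.length))
  obtain ⟨s, t, hst⟩ := CubeFreeWords.exists_cubeFree_joined hn' hm' hn hm
  refine ⟨s.reverse ++ t, ?_⟩
  simpa [CubeFreeWords.joined] using hst
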